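/- Let $q \ge 5$ be a prime power, $F = GF(q)$, $K = GF(q^2)$, $F^* = F\setminus\{0\}$, and let $N : K \to F$ be the norm. Regard $V = K \oplus K$ as a $4$-dimensional $F$-vector space, whose one- and two-dimensional $F$-subspaces are the points and lines of $PG(3,q)$. A spread of $PG(3,q)$ is a set of $q^2+1$ pairwise disjoint lines that partition the points; a regulus is a set of $q+1$ pairwise disjoint lines such that every line meeting three of them meets all of them; a spread is regular if for any three distinct lines of it, it contains a regulus through these three lines. Put $$J(\infty) = \{(x,0) : x \in K\},\qquad J(k) = \{(kx,x) : x \in K\},\qquad J^q(k) = \{(kx^q,x) : x \in K\}\qquad (k \in K),$$ $$\mathcal S = \{J(\infty)\} \cup \{J(k) : k \in K\},\qquad \mathcal S^q = \{J(\infty)\} \cup \{J^q(k) : k \in K\},$$ and, for $f \in F^*$, $\mathcal J_f = \{J(k) : N(k) = f\}$ and $\mathcal J^q_f = \{J^q(k) : N(k) = f\}$. For a subset $I \subseteq F^*$ let $$\mathcal A_I = \{J(\infty), J(0)\} \cup \bigcup_{f \in I} \mathcal J^q_f \cup \bigcup_{f \in F^* \setminus I} \mathcal J_f$$ be the corresponding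 André spread, with index $m = |I|$, and suppose that $2 \le m \le \frac{q-1}{2}$. Then: 1. $\mathcal S$ is a regular spread, and it meets $\mathcal A_I$ in exactly $2 + (q-1-m)(q+1) > 2q+2$ lines. 2. $\mathcal S^q$ is a regular spread, and it meets $\mathcal A_I$ in exactly $2 + m(q+1) > 2q+2$ lines. 3. Every regular spread of $PG(3,q)$ other than $\mathcal S$ and $\mathcal S^q$ meets $\mathcal A_I$ in at most $2q+2$ lines. -/

import Mathlib

namespace AndreSpread

section Projective

/- `PG(3,q)` is modelled by a 4-dimensional vector space `V` over `F = GF(q)`.  Projective points are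
the one-dimensional subspaces and projective lines the two-dimensional ones. -/

variable (F : Type*) [Field F] [Fintype F] {V : Type*} [AddCommGroup V] [Module F V]

/-- A line of the projective space of `V`: a vector subspace of dimension two. -/
def IsLine (L : Submodule F V) : Prop := Module.finrank F L = 2

/-- A spread of `PG(3,q)`: a set of `q ^ 2 + 1` pairwise disjoint lines which partition the points.
Two lines share no projective point exactly when they intersect in the zero subspace. -/
structure IsSpread (T : Set (Submodule F V)) : Prop where
  isLine : ∀ L ∈ T, IsLine F L
  card_eq : T.ncard = Fintype.card F ^ 2 + 1
  disjoint : ∀ L ∈ T, ∀ M ∈ T, L ≠ M → L ⊓ M = ⊥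
  cover : ∀ v : V, v ≠ 0 → ∃ L ∈ T, v ∈ L

/-- A regulus of `PG(3,q)`: a set of `q + 1` pairwise disjoint lines such that any line that meets
three of them meets all of them. -/
structure IsRegulus (R : Set (Submodule F V)) : Prop where
  isLine : ∀ L ∈ R, IsLine F L
  card_eq : R.ncard = Fintype.card F + 1
  disjoint : ∀ L ∈ R, ∀ M ∈ R, L ≠ M → L ⊓ M = ⊥
  transversal : ∀ N : Submodule F V, IsLine F N →
    ∀ A ∈ R, ∀ B ∈ R, ∀ C ∈ R, A ≠ B → A ≠ C → B ≠ C →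
      N ⊓ A ≠ ⊥ → N ⊓ B ≠ ⊥ → N ⊓ C ≠ ⊥ → ∀ D ∈ R, N ⊓ D ≠ ⊥

/-- A regular spread: a spread which contains the regulus through any three of its lines. -/
structure IsRegularSpread (T : Set (Submodule F V)) : Prop where
  isSpread : IsSpread F T
  regulus : ∀ A ∈ T, ∀ B ∈ T, ∀ C ∈ T, A ≠ B → A ≠ C → B ≠ C →
    ∃ R : Set (Submodule F V), IsRegulus F R ∧ A ∈ R ∧ B ∈ R ∧ C ∈ R ∧ R ⊆ T

end Projective

section Coordinates

/- From here on `V = K × K`, with `K = GF(q ^ 2)` regarded as a quadratic extension of `F`. -/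

variable (F K : Type*) [Field F] [Field K] [Algebra F K]

/-- `J(∞) = {(x, 0) : x ∈ K}`. -/
def Jinf : Submodule F (K × K) where
  carrier := {p | ∃ x : K, p = (x, 0)}
  add_mem' := by
    rintro _ _ ⟨x, rfl⟩ ⟨y, rfl⟩
    exact ⟨x + y, by simp⟩
  zero_mem' := ⟨0, rfl⟩
  smul_mem' := by
    rintro c _ ⟨x, rfl⟩
    exact ⟨c • x, by simp⟩

variable {F K}

/-- `J^σ(k) = {(k σ(x), x) : x ∈ K}`, for an `F`-linear field homomorphism `σ` of `K`. -/
def J (σ : K →ₐ[F] K) (k : K) : Submodule F (K × K) where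
  carrier := {p | ∃ x : K, p = (k * σ x, x)}
  add_mem' := by
    rintro _ _ ⟨x, rfl⟩ ⟨y, rfl⟩
    exact ⟨x + y, by simp [mul_add]⟩
  zero_mem' := ⟨0, by simp only [map_zero, mul_zero]; rfl⟩
  smul_mem' := by
    rintro c _ ⟨x, rfl⟩
    exact ⟨c • x, by simp⟩

/-- `S^σ = {J(∞)} ∪ {J^σ(k) : k ∈ K}`. -/
def twistedSpread (σ : K →ₐ[F] K) : Set (Submodule F (K × K)) :=
  {Jinf F K} ∪ {L | ∃ k : K, L = J σ k}

/-- `J^σ_f = {J^σ(k) : N(k) = f}`, where `N` is the norm from `K` to `F`. -/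
def normSurface (σ : K →ₐ[F] K) (f : Fˣ) : Set (Submodule F (K × K)) :=
  {L | ∃ k : K, Algebra.norm F k = (f : F) ∧ L = J σ k}

variable (F K)

/-- The regular spread `S`. -/
def spreadS : Set (Submodule F (K × K)) := twistedSpread (AlgHom.id F K)

variable [Fintype F]

/-- The spread `S^q`, where `q` denotes the automorphism `x ↦ x ^ q` of `K` over `F`. -/
def spreadSq : Set (Submodule F (K × K)) := twistedSpread (FiniteField.frobeniusAlgHom F K)

/-- The André spread `A_I`, obtained from `S` by replacing the regulus `J_f` by `J^q_f` for each
`f ∈ I`. -/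
def andreSpread (I : Set Fˣ) : Set (Submodule F (K × K)) :=
  {Jinf F K, J (AlgHom.id F K) 0}
    ∪ (⋃ f ∈ I, normSurface (FiniteField.frobeniusAlgHom F K) f)
    ∪ (⋃ f ∈ Iᶜ, normSurface (AlgHom.id F K) f)

end Coordinates

end AndreSpread

/-! The main point is rigidity: a regular spread `T` sharing more than q + 1 lines with `S` equals
`S` (`IsRegularSpread.eq_spreadS`). The lines of `S` are the one-dimensional `K`-subspaces of `K ×
K`, so GL(2, K) acts on `S` triply transitively, and three common lines may be taken to be J(∞),
J(0), J(1). The only regulus through these is {J(∞)} ∪ {J(t) : t ∈ F} (`IsRegulus.eq_baseRegulus`),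
so `T` contains it. Applying this after a coordinate change, {k : J(k) ∈ T} contains with any two
points of `K` the affine `F`-line joining them (`IsRegularSpread.affine_mem`). A further common line
supplies a point off the line F of the affine plane `K`, and a line together with a point off it
generates the plane once q > 2.

The `F`-linear involution (x, y) ↦ (x, y^q) exchanges `S` and S^q, so the same rigidity holds for
S^q. Since `A_I` lies in the union of `S` and S^q, any other regular spread meets it in at most 2(q
+ 1) lines.

The exact intersection numbers follow because each nonzero norm value is taken q + 1 times, while
J(∞) and J(0) are the only lines common to `S` and S^q. -/

namespace AndreSpread

/-! ### Invariance of spreads and reguli under linear automorphisms -/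

section Transport

variable {F : Type*} [Field F] {V : Type*} [AddCommGroup V] [Module F V]

/-- The set of subspaces whose image under `e` lies in `T`. -/
def pullback (e : V ≃ₗ[F] V) (T : Set (Submodule F V)) : Set (Submodule F V) :=
  (fun L => L.map (e : V →ₗ[F] V)) ⁻¹' T

lemma mem_pullback (e : V ≃ₗ[F] V) (T : Set (Submodule F V)) (L : Submodule F V) :
    L ∈ pullback e T ↔ L.map (e : V →ₗ[F] V) ∈ T := Iff.rfl

lemma map_equiv_injective (e : V ≃ₗ[F] V) :
    Function.Injective (fun L : Submodule F V => L.map (e : V →ₗ[F] V)) :=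
  Submodule.map_injective_of_injective e.injective

lemma map_map_symm (e : V ≃ₗ[F] V) (L : Submodule F V) :
    (L.map (e.symm : V →ₗ[F] V)).map (e : V →ₗ[F] V) = L := by
  ext x; simp

lemma map_equiv_surjective (e : V ≃ₗ[F] V) :
    Function.Surjective (fun L : Submodule F V => L.map (e : V →ₗ[F] V)) :=
  fun L => ⟨_, map_map_symm e L⟩

lemma ncard_pullback (e : V ≃ₗ[F] V) (T : Set (Submodule F V)) :
    (pullback e T).ncard = T.ncard :=
  Set.ncard_preimage_of_injective_subset_range (map_equiv_injective e)
    (by rw [(map_equiv_surjective e).range_eq]; exact Set.subset_univ _)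

lemma pullback_inter (e : V ≃ₗ[F] V) (T U : Set (Submodule F V)) :
    pullback e (T ∩ U) = pullback e T ∩ pullback e U := rfl

lemma pullback_symm_pullback (e : V ≃ₗ[F] V) (T : Set (Submodule F V)) :
    pullback e (pullback e.symm T) = T := by
  ext L
  rw [mem_pullback, mem_pullback]
  have := map_map_symm e.symm L
  rw [LinearEquiv.symm_symm] at this
  rw [this]

lemma map_inf_eq_bot (e : V ≃ₗ[F] V) (L M : Submodule F V) :
    L.map (e : V →ₗ[F] V) ⊓ M.map (e : V →ₗ[F] V) = ⊥ ↔ L ⊓ M = ⊥ := by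
  rw [← Submodule.map_inf _ e.injective]
  constructor
  · intro h
    exact map_equiv_injective e (by simpa using h)
  · rintro h
    simp [h]

lemma isLine_map (e : V ≃ₗ[F] V) (L : Submodule F V) :
    IsLine F (L.map (e : V →ₗ[F] V)) ↔ IsLine F L := by
  unfold IsLine
  rw [LinearEquiv.finrank_map_eq]

variable [Fintype F]

lemma IsSpread.pullback {T : Set (Submodule F V)} (h : IsSpread F T) (e : V ≃ₗ[F] V) :
    IsSpread F (pullback e T) where
  isLine L hL := (isLine_map e L).1 (h.isLine _ hL)
  card_eq := by rw [ncard_pullback, h.card_eq]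
  disjoint L hL M hM hLM :=
    (map_inf_eq_bot e L M).1 (h.disjoint _ hL _ hM ((map_equiv_injective e).ne hLM))
  cover v hv := by
    obtain ⟨L, hL, hvL⟩ := h.cover (e v) (by simpa using hv)
    obtain ⟨M, rfl⟩ := map_equiv_surjective e L
    exact ⟨M, hL, by simpa using hvL⟩

lemma IsRegulus.pullback {R : Set (Submodule F V)} (h : IsRegulus F R) (e : V ≃ₗ[F] V) :
    IsRegulus F (pullback e R) where
  isLine L hL := (isLine_map e L).1 (h.isLine _ hL)
  card_eq := by rw [ncard_pullback, h.card_eq]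
  disjoint L hL M hM hLM :=
    (map_inf_eq_bot e L M).1 (h.disjoint _ hL _ hM ((map_equiv_injective e).ne hLM))
  transversal N hN A hA B hB C hC hAB hAC hBC hNA hNB hNC D hD := by
    have inj := map_equiv_injective e
    exact fun h0 => h.transversal _ ((isLine_map e N).2 hN) _ hA _ hB _ hC (inj.ne hAB) (inj.ne hAC)
      (inj.ne hBC) (fun h => hNA ((map_inf_eq_bot e _ _).1 h))
      (fun h => hNB ((map_inf_eq_bot e _ _).1 h)) (fun h => hNC ((map_inf_eq_bot e _ _).1 h))
      _ hD ((map_inf_eq_bot e _ _).2 h0)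

lemma IsRegularSpread.pullback {T : Set (Submodule F V)} (h : IsRegularSpread F T)
    (e : V ≃ₗ[F] V) : IsRegularSpread F (pullback e T) where
  isSpread := h.isSpread.pullback e
  regulus A hA B hB C hC hAB hAC hBC := by
    have inj := map_equiv_injective e
    obtain ⟨R, hR, hA, hB, hC, hRT⟩ :=
      h.regulus _ hA _ hB _ hC (inj.ne hAB) (inj.ne hAC) (inj.ne hBC)
    exact ⟨_, hR.pullback e, hA, hB, hC, Set.preimage_mono hRT⟩

end Transport

/-! ### The spread `S` as the projective line over `K` -/

section KLines

variable (F : Type*) {K : Type*} [Field F] [Field K] [Algebra F K]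

/-- The `K`-span of a vector, as an `F`-subspace. -/
def klin (v : K × K) : Submodule F (K × K) := (Submodule.span K {v}).restrictScalars F

variable {F}

lemma mem_klin {v w : K × K} : w ∈ klin F v ↔ ∃ a : K, a • v = w := by
  simp [klin, Submodule.mem_span_singleton]

lemma klin_smul {a : K} (ha : a ≠ 0) (v : K × K) : klin F (a • v) = klin F v := by
  rw [klin, klin, Submodule.span_singleton_smul_eq (IsUnit.mk0 a ha)]

lemma map_klin (e : (K × K) ≃ₗ[K] (K × K)) (v : K × K) :
    (klin F v).map (e.restrictScalars F : (K × K) →ₗ[F] (K × K)) = klin F (e v) := by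
  ext w
  simp only [Submodule.mem_map, mem_klin]
  constructor
  · rintro ⟨_, ⟨a, rfl⟩, rfl⟩
    exact ⟨a, by simp⟩
  · rintro ⟨a, rfl⟩
    exact ⟨a • v, ⟨a, rfl⟩, by simp⟩

lemma Jinf_eq_klin : Jinf F K = klin F (1, 0) := by
  ext w
  rw [mem_klin]
  exact ⟨fun ⟨x, h⟩ => ⟨x, by simp [h]⟩, fun ⟨x, h⟩ => ⟨x, by simp [← h]⟩⟩

lemma J_eq_klin (k : K) : J (AlgHom.id F K) k = klin F (k, 1) := by
  ext w
  rw [mem_klin]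
  exact ⟨fun ⟨x, h⟩ => ⟨x, by simp [h, mul_comm]⟩, fun ⟨x, h⟩ => ⟨x, by simp [← h, mul_comm]⟩⟩

lemma J_injective (σ : K →ₐ[F] K) : Function.Injective (J σ) := by
  intro k l h
  have : ((k * σ 1, 1) : K × K) ∈ J σ l := h ▸ ⟨1, rfl⟩
  obtain ⟨x, hx⟩ := this
  simp only [Prod.mk.injEq] at hx
  obtain ⟨h1, rfl⟩ := hx
  simpa using h1

lemma J_zero (σ τ : K →ₐ[F] K) : J σ 0 = J τ 0 := by
  ext w
  constructor <;>
  · rintro ⟨x, rfl⟩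
    exact ⟨x, by simp⟩

lemma Jinf_ne_J (σ : K →ₐ[F] K) (k : K) : Jinf F K ≠ J σ k := by
  intro h
  have : ((1, 0) : K × K) ∈ J σ k := h ▸ ⟨1, rfl⟩
  obtain ⟨x, hx⟩ := this
  simp only [Prod.mk.injEq] at hx
  obtain ⟨h1, rfl⟩ := hx
  simp at h1

lemma klin_cases {v : K × K} (hv : v ≠ 0) :
    klin F v = Jinf F K ∨ ∃ k, klin F v = J (AlgHom.id F K) k := by
  obtain ⟨a, b⟩ := v
  by_cases hb : b = 0
  · left
    subst hb
    have ha : a ≠ 0 := by rintro rfl; exact hv rfl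
    rw [Jinf_eq_klin, ← klin_smul ha (1, 0)]
    simp
  · right
    refine ⟨a / b, ?_⟩
    rw [J_eq_klin, ← klin_smul hb (a / b, 1)]
    congr 1
    simp only [Prod.smul_mk, smul_eq_mul, mul_one]
    rw [mul_div_cancel₀ _ hb]

/-- This coordinate-free description makes the invariance of `S` under all `K`-linear automorphisms
immediate. -/
lemma mem_spreadS {L : Submodule F (K × K)} :
    L ∈ spreadS F K ↔ ∃ v : K × K, v ≠ 0 ∧ L = klin F v := by
  constructor
  · rintro (rfl | ⟨k, rfl⟩)
    · exact ⟨(1, 0), by simp, Jinf_eq_klin⟩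
    · exact ⟨(k, 1), by simp, J_eq_klin k⟩
  · rintro ⟨v, hv, rfl⟩
    rcases klin_cases (F := F) hv with h | ⟨k, h⟩
    · exact Or.inl h
    · exact Or.inr ⟨k, h⟩

lemma pullback_spreadS (e : (K × K) ≃ₗ[K] (K × K)) :
    pullback (e.restrictScalars F) (spreadS F K) = spreadS F K := by
  ext L
  rw [mem_pullback, mem_spreadS, mem_spreadS]
  constructor
  · rintro ⟨v, hv, h⟩
    refine ⟨e.symm v, by simpa using hv, map_equiv_injective (e.restrictScalars F) ?_⟩
    simp only [h, map_klin, LinearEquiv.apply_symm_apply]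
  · rintro ⟨v, hv, rfl⟩
    exact ⟨e v, by simpa using hv, map_klin e v⟩

lemma isLine_klin (hK : Module.finrank F K = 2) {v : K × K} (hv : v ≠ 0) :
    IsLine F (klin F v) := by
  have : klin F v = LinearMap.range ((LinearMap.toSpanSingleton K (K × K) v).restrictScalars F) := by
    ext w
    simp [mem_klin]
  rw [IsLine, this, LinearMap.finrank_range_of_inj, hK]
  intro a b hab
  exact smul_left_injective K hv (by simpa using hab)

lemma klin_inf_klin {v w : K × K} (h : klin F v ≠ klin F w) : klin F v ⊓ klin F w = ⊥ := by
  rw [eq_bot_iff]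
  rintro x ⟨h1, h2⟩
  obtain ⟨a, rfl⟩ := mem_klin.1 h1
  obtain ⟨b, hb⟩ := mem_klin.1 h2
  rw [Submodule.mem_bot]
  by_contra hx
  have ha : a ≠ 0 := by rintro rfl; simp at hx
  have hb0 : b ≠ 0 := by rintro rfl; simp [← hb] at hx
  exact h (by rw [← klin_smul ha v, ← hb, klin_smul hb0])

lemma pair_independent {u v : K × K} (hu : u ≠ 0) (hv : v ≠ 0) (h : klin F u ≠ klin F v) (a b : K)
    (hab : a • u + b • v = 0) : a = 0 ∧ b = 0 := by
  have h1 : a • u = -(b • v) := eq_neg_of_add_eq_zero_left hab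
  have h2 : a • u ∈ klin F u ⊓ klin F v :=
    ⟨mem_klin.2 ⟨a, rfl⟩, mem_klin.2 ⟨-b, by simp [h1]⟩⟩
  rw [klin_inf_klin h, Submodule.mem_bot] at h2
  have h3 : b • v = 0 := by simpa [h2] using hab
  exact ⟨(smul_eq_zero.1 h2).resolve_right hu, (smul_eq_zero.1 h3).resolve_right hv⟩

/-- The coordinate change taking the standard basis to a given pair of independent vectors. -/
noncomputable def pairEquiv (u v : K × K) (h : ∀ a b : K, a • u + b • v = 0 → a = 0 ∧ b = 0) :
    (K × K) ≃ₗ[K] (K × K) :=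
  LinearEquiv.ofInjectiveEndo
    (LinearMap.coprod (LinearMap.toSpanSingleton K _ u) (LinearMap.toSpanSingleton K _ v)) <| by
    rw [injective_iff_map_eq_zero]
    rintro ⟨a, b⟩ hab
    obtain ⟨rfl, rfl⟩ := h a b (by simpa using hab)
    rfl

lemma pairEquiv_apply (u v : K × K) (h) (x : K × K) :
    pairEquiv u v h x = x.1 • u + x.2 • v := by
  simp [pairEquiv]

/-- Any three distinct `K`-lines are the images of `J(∞)`, `J(0)`, `J(1)` under a coordinate
change. -/
lemma exists_equiv_of_three {A B C : Submodule F (K × K)} (hA : A ∈ spreadS F K)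
    (hB : B ∈ spreadS F K) (hC : C ∈ spreadS F K) (hAB : A ≠ B) (hAC : A ≠ C) (hBC : B ≠ C) :
    ∃ e : (K × K) ≃ₗ[K] (K × K),
      (Jinf F K).map (e.restrictScalars F : (K × K) →ₗ[F] (K × K)) = A ∧
      (J (AlgHom.id F K) 0).map (e.restrictScalars F : (K × K) →ₗ[F] (K × K)) = B ∧
      (J (AlgHom.id F K) 1).map (e.restrictScalars F : (K × K) →ₗ[F] (K × K)) = C := by
  obtain ⟨u, hu, rfl⟩ := mem_spreadS.1 hA
  obtain ⟨v, hv, rfl⟩ := mem_spreadS.1 hB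
  obtain ⟨w, hw, rfl⟩ := mem_spreadS.1 hC
  have huv := pair_independent hu hv hAB
  obtain ⟨⟨a, b⟩, rfl⟩ := (pairEquiv u v huv).surjective w
  simp only [pairEquiv_apply] at hw hAC hBC ⊢
  have ha : a ≠ 0 := by
    rintro rfl
    have hb : b ≠ 0 := by rintro rfl; simp at hw
    simp [klin_smul hb] at hBC
  have hb : b ≠ 0 := by
    rintro rfl
    simp [klin_smul ha] at hAC
  -- The third line is spanned by a • u + b • v with a, b ≠ 0. Rescaling the first two spanning
  -- vectors by a and b makes it the image of the span of (1, 1).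
  refine ⟨pairEquiv (a • u) (b • v) fun x y hxy => ?_, ?_, ?_, ?_⟩
  · have := huv (x * a) (y * b) (by simpa [mul_smul] using hxy)
    simpa [ha, hb] using this
  · rw [Jinf_eq_klin, map_klin]
    simp [pairEquiv_apply, klin_smul ha]
  · rw [J_eq_klin, map_klin]
    simp [pairEquiv_apply, klin_smul hb]
  · rw [J_eq_klin, map_klin]
    simp [pairEquiv_apply]

end KLines

end AndreSpread

namespace AndreSpread

/-! ### The unique regulus through J(∞), J(0) and J(1) -/

section StandardRegulus

variable (F K : Type*) [Field F] [Field K] [Algebra F K]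

/-- The regulus `{J(∞)} ∪ {J(t) : t ∈ F}`. -/
def baseRegulus : Set (Submodule F (K × K)) :=
  insert (Jinf F K) (Set.range fun t : F => J (AlgHom.id F K) (algebraMap F K t))

variable {F K}

lemma baseRegulus_subset : baseRegulus F K ⊆ spreadS F K := by
  rintro _ (rfl | ⟨t, rfl⟩)
  · exact Or.inl rfl
  · exact Or.inr ⟨_, rfl⟩

lemma mem_baseRegulus {L : Submodule F (K × K)} :
    L ∈ baseRegulus F K ↔ ∃ a b : F, (a ≠ 0 ∨ b ≠ 0) ∧
      L = klin F (algebraMap F K a, algebraMap F K b) := by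
  constructor
  · rintro (rfl | ⟨t, rfl⟩)
    · exact ⟨1, 0, by simp, by simp [Jinf_eq_klin]⟩
    · exact ⟨t, 1, by simp, by simp [J_eq_klin]⟩
  · rintro ⟨a, b, hab, rfl⟩
    by_cases hb : b = 0
    · subst hb
      have ha : algebraMap F K a ≠ 0 := by simpa using hab
      left
      rw [Jinf_eq_klin, ← klin_smul ha (1, 0)]
      simp only [Prod.smul_mk, smul_eq_mul, mul_one, mul_zero, map_zero]
    · have hb' : algebraMap F K b ≠ 0 := by simpa using hb
      right
      refine ⟨a / b, ?_⟩
      simp only [J_eq_klin]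
      rw [← klin_smul hb' (_, 1)]
      simp only [Prod.smul_mk, smul_eq_mul, mul_one, map_div₀]
      rw [mul_div_cancel₀ _ hb']

lemma klin_scalar_ne {a b c d : F} (hab : a ≠ 0 ∨ b ≠ 0) (hcd : c ≠ 0 ∨ d ≠ 0)
    (h : klin F (algebraMap F K a, algebraMap F K b) ≠ klin F (algebraMap F K c, algebraMap F K d)) :
    a * d - b * c ≠ 0 := by
  intro h0
  have h0' : algebraMap F K a * algebraMap F K d = algebraMap F K b * algebraMap F K c := by
    rw [← map_mul, ← map_mul, sub_eq_zero.1 h0]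
  apply h
  rcases hab with ha | hb
  · have hc : c ≠ 0 := by
      rintro rfl
      simp_all
    have ha' : algebraMap F K a ≠ 0 := by simpa using ha
    have hc' : algebraMap F K c ≠ 0 := by simpa using hc
    rw [← klin_smul hc' (algebraMap F K a, _), ← klin_smul ha' (algebraMap F K c, _)]
    simp only [Prod.smul_mk, smul_eq_mul, h0']
    rw [mul_comm, mul_comm (algebraMap F K c) (algebraMap F K b)]
  · have hd : d ≠ 0 := by
      rintro rfl
      simp_all
    have hb' : algebraMap F K b ≠ 0 := by simpa using hb
    have hd' : algebraMap F K d ≠ 0 := by simpa using hd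
    rw [← klin_smul hd' (algebraMap F K a, _), ← klin_smul hb' (algebraMap F K c, _)]
    simp only [Prod.smul_mk, smul_eq_mul, ← h0']
    rw [mul_comm, mul_comm (algebraMap F K d) (algebraMap F K b)]

/-- Cramer's rule in the form used for transversals. -/
lemma exists_coords {a b c d : F} (h : a * d - b * c ≠ 0) (x y : F) :
    ∃ s t : F, x = s * a + t * c ∧ y = s * b + t * d :=
  ⟨(x * d - y * c) / (a * d - b * c), (a * y - b * x) / (a * d - b * c),
    by
      rw [div_mul_eq_mul_div, div_mul_eq_mul_div, ← add_div, eq_div_iff h]; ring,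
    by rw [div_mul_eq_mul_div, div_mul_eq_mul_div, ← add_div, eq_div_iff h]; ring⟩

lemma exists_combination (hK : Module.finrank F K = 2) {a : K}
    (ha : a ∉ Set.range (algebraMap F K)) (z : K) :
    ∃ s t : F, z = algebraMap F K s + algebraMap F K t * a := by
  have hli : LinearIndependent F ![(1 : K), a] := by
    rw [LinearIndependent.pair_iff' one_ne_zero]
    rintro c rfl
    exact ha ⟨c, by simp [Algebra.smul_def]⟩
  have htop := hli.span_eq_top_of_card_eq_finrank (by simp [hK])
  rw [Matrix.range_cons_cons_empty] at htop
  have hz : z ∈ Submodule.span F {1, a} := htop ▸ Submodule.mem_top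
  obtain ⟨s, t, h⟩ := Submodule.mem_span_pair.1 hz
  exact ⟨s, t, by simp [← h, Algebra.smul_def]⟩

lemma ncard_baseRegulus [Fintype F] : (baseRegulus F K).ncard = Fintype.card F + 1 := by
  rw [baseRegulus, Set.ncard_insert_of_notMem, Set.ncard_range_of_injective, Nat.card_eq_fintype_card]
  · exact (J_injective _).comp (algebraMap F K).injective
  · rintro ⟨t, ht⟩
    exact Jinf_ne_J _ _ ht.symm

/-- The scalar multiple of `(a, b) ∈ F²` by `g ∈ K`. -/
def scaled (F : Type*) {K : Type*} [Field F] [Field K] [Algebra F K] (g : K) :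
    (F × F) →ₗ[F] (K × K) :=
  LinearMap.prodMap (LinearMap.toSpanSingleton F K g) (LinearMap.toSpanSingleton F K g)

lemma scaled_apply (g : K) (a b : F) : scaled F g (a, b) = (a • g, b • g) := rfl

lemma scaled_eq_smul (g : K) (a b : F) :
    scaled F g (a, b) = g • (algebraMap F K a, algebraMap F K b) := by
  simp [scaled_apply, Algebra.smul_def, mul_comm]

lemma scaled_injective {g : K} (hg : g ≠ 0) : Function.Injective (scaled F g) := by
  have := smul_left_injective F hg
  exact Function.Injective.prodMap this this

/-- A line meeting three lines of the base regulus contains a family of scaled vectors. -/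
lemma exists_scaled_mem {N : Submodule F (K × K)} (hN : IsLine F N) {a₁ b₁ a₂ b₂ a₃ b₃ : F}
    (h12 : a₁ * b₂ - b₁ * a₂ ≠ 0) (h13 : a₁ * b₃ - b₁ * a₃ ≠ 0) (h23 : a₂ * b₃ - b₂ * a₃ ≠ 0)
    (h1 : N ⊓ klin F (algebraMap F K a₁, algebraMap F K b₁) ≠ ⊥)
    (h2 : N ⊓ klin F (algebraMap F K a₂, algebraMap F K b₂) ≠ ⊥)
    (h3 : N ⊓ klin F (algebraMap F K a₃, algebraMap F K b₃) ≠ ⊥) :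
    ∃ g : K, g ≠ 0 ∧ ∀ a b : F, scaled F g (a, b) ∈ N := by
  have key : ∀ {a b : F}, N ⊓ klin F (algebraMap F K a, algebraMap F K b) ≠ ⊥ →
      ∃ g : K, g ≠ 0 ∧ scaled F g (a, b) ∈ N := by
    intro a b h
    obtain ⟨x, ⟨hxN, hx⟩, hx0⟩ := (Submodule.ne_bot_iff _).1 h
    obtain ⟨g, rfl⟩ := mem_klin.1 hx
    refine ⟨g, ?_, by rwa [scaled_eq_smul]⟩
    rintro rfl
    simp at hx0
  obtain ⟨g₁, hg₁, m₁⟩ := key h1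
  obtain ⟨g₂, hg₂, m₂⟩ := key h2
  obtain ⟨g, hg, m⟩ := key h3
  obtain ⟨s, t, rfl, rfl⟩ := exists_coords h12 a₃ b₃
  have hs : s ≠ 0 := by rintro rfl; apply h23; ring
  have ht : t ≠ 0 := by rintro rfl; apply h13; ring
  have hdet : algebraMap F K a₁ * algebraMap F K b₂ - algebraMap F K b₁ * algebraMap F K a₂ ≠ 0 := by
    rw [← map_mul, ← map_mul, ← map_sub]
    exact (map_ne_zero _).2 h12
  -- Vectors independent over `F` stay independent over `K`, so coefficients in `K` may be compared.
  have comb : ∀ x y : K, x * algebraMap F K a₁ + y * algebraMap F K a₂ = 0 →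
      x * algebraMap F K b₁ + y * algebraMap F K b₂ = 0 → x = 0 ∧ y = 0 := by
    intro x y e1 e2
    constructor
    · refine (mul_eq_zero.1 (?_ : x * _ = 0)).resolve_right hdet
      linear_combination algebraMap F K b₂ * e1 - algebraMap F K a₂ * e2
    · refine (mul_eq_zero.1 (?_ : y * _ = 0)).resolve_right hdet
      linear_combination -algebraMap F K b₁ * e1 + algebraMap F K a₁ * e2
  have hli : LinearIndependent F ![scaled F g₁ (a₁, b₁), scaled F g₂ (a₂, b₂)] := by
    rw [LinearIndependent.pair_iff]
    intro x y hxy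
    simp only [scaled_apply, Prod.smul_mk, Prod.mk_add_mk, Prod.mk_eq_zero] at hxy
    simp only [Algebra.smul_def] at hxy
    obtain ⟨h1, h2⟩ := comb (algebraMap F K x * g₁) (algebraMap F K y * g₂)
      (by linear_combination hxy.1) (by linear_combination hxy.2)
    simpa [hg₁, hg₂] using And.intro h1 h2
  have hspan : Submodule.span F {scaled F g₁ (a₁, b₁), scaled F g₂ (a₂, b₂)} = N := by
    have : FiniteDimensional F N := FiniteDimensional.of_finrank_pos (by rw [show _ = 2 from hN]; simp)
    apply Submodule.eq_of_le_of_finrank_eq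
    · rw [Submodule.span_le]
      rintro _ (rfl | rfl) <;> assumption
    · have := finrank_span_eq_card hli
      rw [Matrix.range_cons_cons_empty] at this
      rw [this, show _ = 2 from hN, Fintype.card_fin]
  rw [← hspan, Submodule.mem_span_pair] at m
  obtain ⟨x, y, hxy⟩ := m
  simp only [scaled_apply, Prod.smul_mk, Prod.mk_add_mk, Prod.mk.injEq] at hxy
  simp only [Algebra.smul_def, map_add, map_mul] at hxy
  -- Comparing the two expressions for the third point gives x g₁ = s g and y g₂ = t g. As s, t ≠ 0,
  -- the multiples of g by the first two base vectors are `F`-multiples of vectors already in `N`.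
  obtain ⟨e1, e2⟩ := comb (algebraMap F K x * g₁ - algebraMap F K s * g)
    (algebraMap F K y * g₂ - algebraMap F K t * g)
    (by linear_combination hxy.1) (by linear_combination hxy.2)
  have m1 : scaled F g (a₁, b₁) ∈ N := by
    have : scaled F g (a₁, b₁) = (s⁻¹ * x) • scaled F g₁ (a₁, b₁) := by
      have hs' : algebraMap F K s ≠ 0 := by simpa using hs
      have : g = algebraMap F K (s⁻¹ * x) * g₁ := by
        rw [map_mul, map_inv₀, mul_assoc, eq_inv_mul_iff_mul_eq₀ hs']
        linear_combination -e1
      rw [scaled_eq_smul, scaled_eq_smul, ← algebraMap_smul K (s⁻¹ * x), smul_smul,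
        ← this]
    rw [this]
    exact N.smul_mem _ m₁
  have m2 : scaled F g (a₂, b₂) ∈ N := by
    have : scaled F g (a₂, b₂) = (t⁻¹ * y) • scaled F g₂ (a₂, b₂) := by
      have ht' : algebraMap F K t ≠ 0 := by simpa using ht
      have : g = algebraMap F K (t⁻¹ * y) * g₂ := by
        rw [map_mul, map_inv₀, mul_assoc, eq_inv_mul_iff_mul_eq₀ ht']
        linear_combination -e2
      rw [scaled_eq_smul, scaled_eq_smul, ← algebraMap_smul K (t⁻¹ * y), smul_smul,
        ← this]
    rw [this]
    exact N.smul_mem _ m₂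
  refine ⟨g, hg, fun a b => ?_⟩
  obtain ⟨p, r, rfl, rfl⟩ := exists_coords h12 a b
  have : ((p * a₁ + r * a₂, p * b₁ + r * b₂) : F × F) = p • (a₁, b₁) + r • (a₂, b₂) := by simp
  rw [this, map_add, map_smul, map_smul]
  exact N.add_mem (N.smul_mem _ m1) (N.smul_mem _ m2)

/-- A line meeting three members contains g · F² for some g ≠ 0, and this meets the `K`-span of
every nonzero vector of F². -/
lemma isRegulus_baseRegulus [Fintype F] (hK : Module.finrank F K = 2) :
    IsRegulus F (baseRegulus F K) where
  isLine L hL := by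
    obtain ⟨v, hv, rfl⟩ := mem_spreadS.1 (baseRegulus_subset hL)
    exact isLine_klin hK hv
  card_eq := ncard_baseRegulus
  disjoint L hL M hM hLM := by
    obtain ⟨v, hv, rfl⟩ := mem_spreadS.1 (baseRegulus_subset hL)
    obtain ⟨w, hw, rfl⟩ := mem_spreadS.1 (baseRegulus_subset hM)
    exact klin_inf_klin hLM
  transversal N hN A hA B hB C hC hAB hAC hBC hNA hNB hNC D hD := by
    obtain ⟨a₁, b₁, h₁, rfl⟩ := mem_baseRegulus.1 hA
    obtain ⟨a₂, b₂, h₂, rfl⟩ := mem_baseRegulus.1 hB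
    obtain ⟨a₃, b₃, h₃, rfl⟩ := mem_baseRegulus.1 hC
    obtain ⟨a, b, h, rfl⟩ := mem_baseRegulus.1 hD
    obtain ⟨g, hg, hgN⟩ := exists_scaled_mem hN (klin_scalar_ne h₁ h₂ hAB)
      (klin_scalar_ne h₁ h₃ hAC) (klin_scalar_ne h₂ h₃ hBC) hNA hNB hNC
    rw [Submodule.ne_bot_iff]
    refine ⟨scaled F g (a, b), ⟨hgN a b, mem_klin.2 ⟨g, (scaled_eq_smul g a b).symm⟩⟩, ?_⟩
    rw [Ne, map_eq_zero_iff _ (scaled_injective hg), Prod.mk_eq_zero]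
    tauto

lemma isLine_range_scaled {g : K} (hg : g ≠ 0) : IsLine F (LinearMap.range (scaled F g)) := by
  rw [IsLine, LinearMap.finrank_range_of_inj (scaled_injective hg)]
  simp

lemma range_scaled_inf_ne_bot {g : K} (hg : g ≠ 0) {a b : F} (hab : a ≠ 0 ∨ b ≠ 0) :
    LinearMap.range (scaled F g) ⊓ klin F (algebraMap F K a, algebraMap F K b) ≠ ⊥ := by
  rw [Submodule.ne_bot_iff]
  refine ⟨scaled F g (a, b), ⟨⟨_, rfl⟩, mem_klin.2 ⟨g, (scaled_eq_smul g a b).symm⟩⟩, ?_⟩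
  rw [Ne, map_eq_zero_iff _ (scaled_injective hg), Prod.mk_eq_zero]
  tauto

/-- The base regulus is the only regulus containing `J(∞)`, `J(0)` and `J(1)`. -/
lemma IsRegulus.eq_baseRegulus [Fintype F] (hK : Module.finrank F K = 2)
    {R : Set (Submodule F (K × K))} (hR : IsRegulus F R) (hinf : Jinf F K ∈ R)
    (h0 : J (AlgHom.id F K) 0 ∈ R) (h1 : J (AlgHom.id F K) 1 ∈ R) : R = baseRegulus F K := by
  have hfin : (baseRegulus F K).Finite := by
    apply Set.finite_of_ncard_ne_zero
    rw [ncard_baseRegulus]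
    simp
  refine Set.eq_of_subset_of_ncard_le (fun D hD => ?_) ?_ hfin
  swap
  · rw [ncard_baseRegulus, hR.card_eq]
  by_cases hDinf : D = Jinf F K
  · exact Or.inl hDinf
  have hdisj := hR.disjoint D hD _ hinf hDinf
  have hzero : ∀ x : K, (x, (0 : K)) ∈ D → x = 0 := by
    intro x hx
    have : ((x, 0) : K × K) ∈ D ⊓ Jinf F K := ⟨hx, x, rfl⟩
    rw [hdisj] at this
    simpa using this
  -- The line g · F² meets J(∞), J(0) and J(1), hence also `D`. The common vector has nonzero second
  -- coordinate because `D` misses J(∞), so it can be normalised to (s g, g).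
  have hex : ∀ g : K, ∃ s : F, (s • g, g) ∈ D := by
    intro g
    by_cases hg : g = 0
    · exact ⟨0, by rw [hg, smul_zero]; exact D.zero_mem⟩
    have hmeet := hR.transversal _ (isLine_range_scaled (F := F) hg) _ hinf _ h0 _ h1
      (Jinf_ne_J _ _) (Jinf_ne_J _ _) ((J_injective _).ne zero_ne_one)
      (by simpa [Jinf_eq_klin] using range_scaled_inf_ne_bot (F := F) hg (a := 1) (b := 0) (by simp))
      (by simpa [J_eq_klin] using range_scaled_inf_ne_bot (F := F) hg (a := 0) (b := 1) (by simp))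
      (by simpa [J_eq_klin] using range_scaled_inf_ne_bot (F := F) hg (a := 1) (b := 1) (by simp))
      D hD
    obtain ⟨x, ⟨⟨⟨a, b⟩, rfl⟩, hx⟩, hx0⟩ := (Submodule.ne_bot_iff _).1 hmeet
    rw [scaled_apply] at hx hx0
    have hb : b ≠ 0 := by
      rintro rfl
      have := hzero (a • g) (by simpa using hx)
      simp [this] at hx0
    refine ⟨b⁻¹ * a, ?_⟩
    have := D.smul_mem b⁻¹ hx
    simpa [Prod.smul_mk, smul_smul, hb] using this
  choose s hs using hex
  -- The slope s(g) a priori depends on g. Additivity of `D` at g and 1 gives (s(g + 1) - s(g)) g =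
  -- s(1) - s(g + 1). Either the left coefficient vanishes and s(g) = s(1), or g is a scalar and the
  -- vector is a multiple of (s(1), 1).
  have hsub : ∀ g : K, (s 1 • g, g) ∈ D := by
    intro g
    have e := D.sub_mem (D.sub_mem (hs (g + 1)) (hs g)) (hs 1)
    have e' := hzero (s (g + 1) • (g + 1) - s g • g - s 1 • 1) (by simpa using e)
    have e2 : (s (g + 1) - s g) • g = (s 1 - s (g + 1)) • (1 : K) := by
      simp only [sub_smul, smul_add] at e' ⊢
      linear_combination e'
    by_cases hc : s (g + 1) - s g = 0
    · rw [hc, zero_smul, eq_comm, smul_eq_zero, sub_eq_zero] at e2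
      have : s 1 = s g := by
        rw [e2.resolve_right one_ne_zero, sub_eq_zero.1 hc]
      rw [this]
      exact hs g
    · have hg : g = ((s (g + 1) - s g)⁻¹ * (s 1 - s (g + 1))) • (1 : K) := by
        rw [mul_smul, ← e2, smul_smul, inv_mul_cancel₀ hc, one_smul]
      have := D.smul_mem ((s (g + 1) - s g)⁻¹ * (s 1 - s (g + 1))) (hs 1)
      rw [Prod.smul_mk, smul_comm, ← hg] at this
      exact this
  right
  refine ⟨s 1, ?_⟩
  have hD2 := hR.isLine D hD
  have : FiniteDimensional F D := FiniteDimensional.of_finrank_pos (by rw [show _ = 2 from hD2]; simp)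
  apply Submodule.eq_of_le_of_finrank_eq
  · rintro _ ⟨x, rfl⟩
    simpa [Algebra.smul_def] using hsub x
  · have := isLine_klin hK (v := (algebraMap F K (s 1), 1)) (by simp)
    rw [← J_eq_klin] at this
    exact this.trans hD2.symm

lemma IsRegularSpread.baseRegulus_subset [Fintype F] (hK : Module.finrank F K = 2)
    {T : Set (Submodule F (K × K))} (hT : IsRegularSpread F T) (hinf : Jinf F K ∈ T)
    (h0 : J (AlgHom.id F K) 0 ∈ T) (h1 : J (AlgHom.id F K) 1 ∈ T) : baseRegulus F K ⊆ T := by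
  obtain ⟨R, hR, hi, h0, h1, hRT⟩ := hT.regulus _ hinf _ h0 _ h1 (Jinf_ne_J _ _) (Jinf_ne_J _ _)
    ((J_injective _).ne zero_ne_one)
  rwa [← hR.eq_baseRegulus hK hi h0 h1]

end StandardRegulus

end AndreSpread

namespace AndreSpread

/-! ### Regularity and rigidity of `S` -/

section RegularSpreads

variable {F K : Type*} [Field F] [Field K] [Algebra F K] [Fintype F]

lemma finite_of_finrank_two (hK : Module.finrank F K = 2) : Finite K := by
  have : FiniteDimensional F K := FiniteDimensional.of_finrank_pos (by simp [hK])
  exact Module.finite_of_finite F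

lemma natCard_eq_sq (hK : Module.finrank F K = 2) : Nat.card K = Fintype.card F ^ 2 := by
  have : FiniteDimensional F K := FiniteDimensional.of_finrank_pos (by simp [hK])
  rw [Module.natCard_eq_pow_finrank (K := F), hK, Nat.card_eq_fintype_card]

lemma isSpread_spreadS (hK : Module.finrank F K = 2) : IsSpread F (spreadS F K) where
  isLine L hL := by
    obtain ⟨v, hv, rfl⟩ := mem_spreadS.1 hL
    exact isLine_klin hK hv
  card_eq := by
    have := finite_of_finrank_two hK
    have h : spreadS F K = insert (Jinf F K) (Set.range (J (AlgHom.id F K))) := by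
      ext L
      simp [spreadS, twistedSpread, eq_comm]
    rw [h, Set.ncard_insert_of_notMem, Set.ncard_range_of_injective (J_injective _),
      natCard_eq_sq hK]
    rintro ⟨k, hk⟩
    exact Jinf_ne_J _ _ hk.symm
  disjoint L hL M hM hLM := by
    obtain ⟨v, hv, rfl⟩ := mem_spreadS.1 hL
    obtain ⟨w, hw, rfl⟩ := mem_spreadS.1 hM
    exact klin_inf_klin hLM
  cover v hv := ⟨klin F v, mem_spreadS.2 ⟨v, hv, rfl⟩, mem_klin.2 ⟨1, one_smul _ _⟩⟩

lemma isRegularSpread_spreadS (hK : Module.finrank F K = 2) :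
    IsRegularSpread F (spreadS F K) where
  isSpread := isSpread_spreadS hK
  regulus A hA B hB C hC hAB hAC hBC := by
    obtain ⟨e, rfl, rfl, rfl⟩ := exists_equiv_of_three hA hB hC hAB hAC hBC
    have key : ∀ L, L.map (e.restrictScalars F : (K × K) →ₗ[F] (K × K)) ∈
        pullback (e.restrictScalars F).symm (baseRegulus F K) ↔ L ∈ baseRegulus F K := fun L => by
      rw [← mem_pullback, pullback_symm_pullback]
    refine ⟨pullback (e.restrictScalars F).symm (baseRegulus F K),
      (isRegulus_baseRegulus hK).pullback _, (key _).2 ?_, (key _).2 ?_, (key _).2 ?_, ?_⟩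
    · exact Or.inl rfl
    · exact Or.inr ⟨0, by simp⟩
    · exact Or.inr ⟨1, by simp⟩
    · exact (Set.preimage_mono baseRegulus_subset).trans (pullback_spreadS e.symm).subset

/-- The coordinate change `e` fixes J(∞) and sends J(s) to J(x + s(y - x)), so it carries the base
regulus to the regulus labelled by the affine `F`-line through x and y. -/
lemma IsRegularSpread.affine_mem (hK : Module.finrank F K = 2)
    {T : Set (Submodule F (K × K))} (hT : IsRegularSpread F T) (hinf : Jinf F K ∈ T) {x y : K}
    (hx : J (AlgHom.id F K) x ∈ T) (hy : J (AlgHom.id F K) y ∈ T) (t : F) :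
    J (AlgHom.id F K) (x + algebraMap F K t * (y - x)) ∈ T := by
  by_cases hxy : y - x = 0
  · simpa [hxy] using hx
  let e : (K × K) ≃ₗ[K] (K × K) := pairEquiv (y - x, 0) (x, 1) fun a b hab => by
    simp only [Prod.smul_mk, smul_eq_mul, mul_zero, mul_one, Prod.mk_add_mk, zero_add,
      Prod.mk_eq_zero] at hab
    obtain ⟨h1, rfl⟩ := hab
    simpa [hxy] using h1
  have hJ : ∀ s : K, (J (AlgHom.id F K) s).map (e.restrictScalars F : (K × K) →ₗ[F] (K × K)) =
      J (AlgHom.id F K) (x + s * (y - x)) := by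
    intro s
    rw [J_eq_klin, map_klin, J_eq_klin, pairEquiv_apply]
    simp [add_comm]
  have hJinf : (Jinf F K).map (e.restrictScalars F : (K × K) →ₗ[F] (K × K)) = Jinf F K := by
    rw [Jinf_eq_klin, map_klin, pairEquiv_apply, ← klin_smul hxy (1, 0)]
    simp
  have hsub := (hT.pullback (e.restrictScalars F)).baseRegulus_subset hK
    (by rwa [mem_pullback, hJinf]) (by rw [mem_pullback, hJ]; simpa using hx)
    (by rw [mem_pullback, hJ]; simpa using hy)
  have := hsub (Or.inr ⟨t, rfl⟩)
  rwa [mem_pullback, hJ] at this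

lemma IsRegularSpread.spreadS_subset (hK : Module.finrank F K = 2) (hF : 2 < Fintype.card F)
    {T : Set (Submodule F (K × K))} (hT : IsRegularSpread F T) (hinf : Jinf F K ∈ T)
    (h0 : J (AlgHom.id F K) 0 ∈ T) (h1 : J (AlgHom.id F K) 1 ∈ T)
    (hcard : Fintype.card F + 1 < (T ∩ spreadS F K).ncard) : spreadS F K ⊆ T := by
  have hbase := hT.baseRegulus_subset hK hinf h0 h1
  have hmemF : ∀ s : F, J (AlgHom.id F K) (algebraMap F K s) ∈ T :=
    fun s => hbase (Or.inr ⟨s, rfl⟩)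
  -- If every common label were in `F`, the common lines would lie in the base regulus, which has
  -- only q + 1 lines.
  obtain ⟨a, haT, ha⟩ : ∃ a, J (AlgHom.id F K) a ∈ T ∧ a ∉ Set.range (algebraMap F K) := by
    by_contra! hcon
    have hsub : T ∩ spreadS F K ⊆ baseRegulus F K := by
      rintro L ⟨hL, rfl | ⟨k, rfl⟩⟩
      · exact Or.inl rfl
      · obtain ⟨s, rfl⟩ := hcon k hL
        exact Or.inr ⟨s, rfl⟩
    have hfin : (baseRegulus F K).Finite := by
      apply Set.finite_of_ncard_ne_zero
      rw [ncard_baseRegulus]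
      simp
    have := Set.ncard_le_ncard hsub hfin
    rw [ncard_baseRegulus] at this
    omega
  -- The line through a and the point s / (1 - t) of `F` passes through s + t a. This reaches
  -- everything off the parallel to `F` through a.
  have hoff : ∀ s t : F, t ≠ 1 → J (AlgHom.id F K) (algebraMap F K s + algebraMap F K t * a) ∈ T := by
    intro s t ht
    have ht' : (1 - algebraMap F K t) ≠ 0 := by
      rw [← map_one (algebraMap F K), ← map_sub]
      exact (map_ne_zero _).2 (sub_ne_zero.2 ht.symm)
    have := hT.affine_mem hK hinf (hmemF (s / (1 - t))) haT t
    convert this using 2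
    simp only [map_div₀, map_sub, map_one]
    field_simp
    ring
  classical
  obtain ⟨c, hc0, hc1⟩ : ∃ c : F, c ≠ 0 ∧ c ≠ 1 := by
    obtain ⟨c, hc⟩ := Finset.exists_mem_notMem_of_card_lt_card
      (s := ({0, 1} : Finset F)) (t := Finset.univ)
      ((Finset.card_le_two).trans_lt hF)
    exact ⟨c, by simpa using hc⟩
  rintro _ (rfl | ⟨z, rfl⟩)
  · exact hinf
  obtain ⟨s, t, rfl⟩ := exists_combination hK ha z
  by_cases ht : t = 1
  · subst ht
    have hc0' : algebraMap F K c ≠ 0 := (map_ne_zero _).2 hc0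
    have hc1' : algebraMap F K c - 1 ≠ 0 := by
      rw [← map_one (algebraMap F K), ← map_sub]
      exact (map_ne_zero _).2 (sub_ne_zero.2 hc1)
    -- A point s + a of the missing parallel lies on the line joining s c / (c - 1) in `F` to c a.
    -- The latter is already in the set because c ≠ 1.
    have := hT.affine_mem hK hinf (hmemF (s * c / (c - 1))) (hoff 0 c hc1) c⁻¹
    convert this using 2
    simp only [map_div₀, map_sub, map_one, map_inv₀, map_mul, map_zero]
    field_simp
    ring
  · exact hoff s t ht

/-- A regular spread sharing more than `q + 1` lines with `S` is `S`. -/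
lemma IsRegularSpread.eq_spreadS (hK : Module.finrank F K = 2) (hF : 2 < Fintype.card F)
    {T : Set (Submodule F (K × K))} (hT : IsRegularSpread F T)
    (hcard : Fintype.card F + 1 < (T ∩ spreadS F K).ncard) : T = spreadS F K := by
  have hfinT : T.Finite := Set.finite_of_ncard_ne_zero (by rw [hT.isSpread.card_eq]; simp)
  obtain ⟨A, B, C, hA, hB, hC, hAB, hAC, hBC⟩ :=
    (Set.two_lt_ncard_iff (hfinT.inter_of_left _)).1 (lt_trans (by omega) hcard)
  obtain ⟨e, rfl, rfl, rfl⟩ := exists_equiv_of_three hA.2 hB.2 hC.2 hAB hAC hBC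
  have hsub := (hT.pullback (e.restrictScalars F)).spreadS_subset hK hF hA.1 hB.1 hC.1 (by
    rwa [← ncard_pullback (e.restrictScalars F), pullback_inter,
      pullback_spreadS] at hcard)
  symm
  refine Set.eq_of_subset_of_ncard_le (fun L hL => ?_) ?_ hfinT
  · obtain ⟨M, rfl⟩ := map_equiv_surjective (e.restrictScalars F) L
    exact hsub ((pullback_spreadS e).subset hL)
  · rw [hT.isSpread.card_eq, (isSpread_spreadS hK).card_eq]

end RegularSpreads

/-! ### Transfer from `S` to S^q by the Frobenius involution -/

section Frobenius

variable {F K : Type*} [Field F] [Field K] [Algebra F K] [Fintype F]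

lemma frobenius_frobenius (hK : Module.finrank F K = 2) (x : K) :
    FiniteField.frobeniusAlgHom F K (FiniteField.frobeniusAlgHom F K x) = x := by
  have := finite_of_finrank_two hK
  have := Fintype.ofFinite K
  simp only [FiniteField.coe_frobeniusAlgHom]
  rw [← pow_mul, ← sq, ← natCard_eq_sq hK, Nat.card_eq_fintype_card, FiniteField.pow_card]

/-- The involution `(x, y) ↦ (x, y ^ q)`. -/
noncomputable def frobSnd (hK : Module.finrank F K = 2) : (K × K) ≃ₗ[F] (K × K) :=
  LinearEquiv.ofInvolutive
    (LinearMap.prodMap LinearMap.id (FiniteField.frobeniusAlgHom F K).toLinearMap)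
    fun x => Prod.ext rfl (frobenius_frobenius hK x.2)

lemma frobSnd_apply (hK : Module.finrank F K = 2) (x : K × K) :
    frobSnd hK x = (x.1, FiniteField.frobeniusAlgHom F K x.2) := rfl

lemma map_frobSnd_Jinf (hK : Module.finrank F K = 2) :
    (Jinf F K).map (frobSnd hK : (K × K) →ₗ[F] (K × K)) = Jinf F K := by
  ext w
  constructor
  · rintro ⟨_, ⟨x, rfl⟩, rfl⟩
    exact ⟨x, by simp [frobSnd_apply]⟩
  · rintro ⟨x, rfl⟩
    exact ⟨(x, 0), ⟨x, rfl⟩, by simp [frobSnd_apply]⟩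

/-- The vector (k x^q, x) goes to (k x^q, x^q), and x^q runs over all of `K`. -/
lemma map_frobSnd_J (hK : Module.finrank F K = 2) (k : K) :
    (J (FiniteField.frobeniusAlgHom F K) k).map (frobSnd hK : (K × K) →ₗ[F] (K × K)) =
      J (AlgHom.id F K) k := by
  ext w
  constructor
  · rintro ⟨_, ⟨x, rfl⟩, rfl⟩
    exact ⟨FiniteField.frobeniusAlgHom F K x, rfl⟩
  · rintro ⟨x, rfl⟩
    refine ⟨_, ⟨FiniteField.frobeniusAlgHom F K x, rfl⟩, ?_⟩
    simp only [LinearEquiv.coe_coe, frobSnd_apply, frobenius_frobenius hK]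
    rfl

lemma pullback_frobSnd (hK : Module.finrank F K = 2) :
    pullback (frobSnd hK) (spreadS F K) = spreadSq F K := by
  have inj := map_equiv_injective (frobSnd (F := F) hK)
  ext L
  rw [mem_pullback]
  constructor
  · rintro (h | ⟨k, h⟩)
    · exact Or.inl (inj (h.trans (map_frobSnd_Jinf hK).symm))
    · exact Or.inr ⟨k, inj (h.trans (map_frobSnd_J hK k).symm)⟩
  · rintro (rfl | ⟨k, rfl⟩)
    · exact Or.inl (map_frobSnd_Jinf hK)
    · exact Or.inr ⟨k, map_frobSnd_J hK k⟩

lemma isRegularSpread_spreadSq (hK : Module.finrank F K = 2) :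
    IsRegularSpread F (spreadSq F K) := by
  rw [← pullback_frobSnd hK]
  exact (isRegularSpread_spreadS hK).pullback _

/-- A regular spread sharing more than `q + 1` lines with `S^q` is `S^q`. -/
lemma IsRegularSpread.eq_spreadSq (hK : Module.finrank F K = 2) (hF : 2 < Fintype.card F)
    {T : Set (Submodule F (K × K))} (hT : IsRegularSpread F T)
    (hcard : Fintype.card F + 1 < (T ∩ spreadSq F K).ncard) : T = spreadSq F K := by
  have h := (hT.pullback (frobSnd hK).symm).eq_spreadS hK hF (by
    rwa [← ncard_pullback (frobSnd hK), pullback_inter, pullback_frobSnd, pullback_symm_pullback])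
  rw [← pullback_frobSnd hK, ← h, pullback_symm_pullback]

/-- Otherwise X^q - X, of degree q, would have q² roots. -/
lemma exists_frobenius_ne (hK : Module.finrank F K = 2) :
    ∃ x : K, FiniteField.frobeniusAlgHom F K x ≠ x := by
  by_contra! h
  classical
  have := finite_of_finrank_two hK
  have := Fintype.ofFinite K
  have hq : 1 < Fintype.card F := Fintype.one_lt_card
  have hle := Polynomial.card_roots' (Polynomial.X ^ Fintype.card F - Polynomial.X : Polynomial K)
  have hne := FiniteField.X_pow_card_sub_X_ne_zero K hq
  have hsub : Finset.univ ⊆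
      (Polynomial.X ^ Fintype.card F - Polynomial.X : Polynomial K).roots.toFinset := by
    intro x _
    rw [Multiset.mem_toFinset, Polynomial.mem_roots hne]
    simpa [sub_eq_zero, FiniteField.coe_frobeniusAlgHom] using h x
  have h1 := Finset.card_le_card hsub
  have h2 := Multiset.toFinset_card_le
    (Polynomial.X ^ Fintype.card F - Polynomial.X : Polynomial K).roots
  rw [FiniteField.X_pow_card_sub_X_natDegree_eq K hq] at hle
  have h3 := natCard_eq_sq (F := F) hK
  rw [Nat.card_eq_fintype_card] at h3
  rw [Finset.card_univ, h3] at h1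
  nlinarith

/-- Equality would give k x^q = l x for all x. Putting x = 1 yields k = l, and cancelling k makes
Frobenius the identity. -/
lemma J_ne_J_frobenius (hK : Module.finrank F K = 2) {k : K} (hk : k ≠ 0) (l : K) :
    J (AlgHom.id F K) l ≠ J (FiniteField.frobeniusAlgHom F K) k := by
  intro h
  have hmem : ∀ x : K, k * FiniteField.frobeniusAlgHom F K x = l * x := by
    intro x
    have : ((l * x, x) : K × K) ∈ J (FiniteField.frobeniusAlgHom F K) k := h ▸ ⟨x, rfl⟩
    obtain ⟨y, hy⟩ := this
    simp only [Prod.mk.injEq] at hy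
    obtain ⟨h1, rfl⟩ := hy
    exact h1.symm
  have hkl : k = l := by simpa using hmem 1
  subst hkl
  obtain ⟨x, hx⟩ := exists_frobenius_ne (F := F) hK
  exact hx (mul_left_cancel₀ hk (hmem x))

end Frobenius

/-! ### Norm fibres and intersections with the André spread -/

section Counting

variable {F K : Type*} [Field F] [Field K] [Algebra F K] [Fintype F]

/-- The elements of `K` whose norm lies in `I`. -/
def normIn (K : Type*) [Field K] [Algebra F K] (I : Set Fˣ) : Set K :=
  {k | ∃ f ∈ I, Algebra.norm F k = (f : F)}

lemma ne_zero_of_mem_normIn (hK : Module.finrank F K = 2) {I : Set Fˣ} {k : K}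
    (hk : k ∈ normIn K I) : k ≠ 0 := by
  rintro rfl
  have := finite_of_finrank_two hK
  obtain ⟨f, -, h⟩ := hk
  rw [Algebra.norm_zero] at h
  exact f.ne_zero h.symm

lemma ncard_normIn (hK : Module.finrank F K = 2) (I : Set Fˣ) :
    (normIn K I).ncard = I.ncard * (Fintype.card F + 1) := by
  classical
  have := finite_of_finrank_two hK
  have := Fintype.ofFinite K
  let N : Kˣ →* Fˣ := Units.map (Algebra.norm F (S := K))
  have hsurj : Function.Surjective N := FiniteField.unitsMap_norm_surjective F K
  have hq : 1 < Fintype.card F := Fintype.one_lt_card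
  have hK2 := natCard_eq_sq (F := F) hK
  rw [Nat.card_eq_fintype_card] at hK2
  -- The norm on units is surjective, so its q - 1 fibres have equal size, and q² - 1 = (q - 1)(q +
  -- 1).
  have hfib : ∀ f : Fˣ, (Finset.univ.filter fun u => N u = f).card = Fintype.card F + 1 := by
    have hconst : ∀ f g : Fˣ, (Finset.univ.filter fun u => N u = f).card =
        (Finset.univ.filter fun u => N u = g).card :=
      fun f g => MonoidHom.card_fiber_eq_of_mem_range N (hsurj f) (hsurj g)
    intro f
    have hsum := Finset.card_eq_sum_card_fiberwise (f := N) (s := Finset.univ) (t := Finset.univ)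
      (fun _ _ => Finset.mem_coe.2 (Finset.mem_univ _))
    rw [Finset.sum_congr rfl fun g _ => hconst g f, Finset.sum_const, Finset.card_univ,
      Finset.card_univ, Fintype.card_units, Fintype.card_units, hK2, smul_eq_mul] at hsum
    obtain ⟨r, hr⟩ : ∃ r, Fintype.card F = r + 2 := ⟨Fintype.card F - 2, by omega⟩
    rw [hr] at hsum ⊢
    have h1 : (r + 2) ^ 2 - 1 = (r + 1) * (r + 2 + 1) := by
      have : (r + 2) ^ 2 = (r + 1) * (r + 2 + 1) + 1 := by ring
      omega
    rw [h1] at hsum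
    exact (Nat.eq_of_mul_eq_mul_left (by omega) hsum).symm
  have himg : normIn K I =
      (fun u : Kˣ => (u : K)) '' ((Finset.univ.filter fun u => N u ∈ I.toFinset : Finset Kˣ) : Set Kˣ) := by
    ext k
    constructor
    · intro hk
      have hk0 := ne_zero_of_mem_normIn hK hk
      obtain ⟨f, hf, h⟩ := hk
      refine ⟨Units.mk0 k hk0, ?_, rfl⟩
      have : N (Units.mk0 k hk0) = f := Units.ext h
      simpa [this] using hf
    · rintro ⟨u, hu, rfl⟩
      exact ⟨N u, by simpa using hu, rfl⟩
  rw [himg, Set.ncard_image_of_injective _ Units.val_injective, Set.ncard_coe_finset,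
    Finset.card_eq_sum_card_fiberwise (f := N) (t := I.toFinset) (fun u hu => by simpa using hu),
    Set.ncard_eq_toFinset_card']
  rw [Finset.sum_congr rfl (g := fun _ => Fintype.card F + 1), Finset.sum_const, smul_eq_mul]
  intro f hf
  rw [← hfib f, Finset.filter_filter]
  congr 1
  ext u
  simp only [Finset.mem_filter, Finset.mem_univ, true_and]
  constructor
  · exact fun h => h.2
  · rintro rfl
    exact ⟨hf, rfl⟩

lemma mem_andreSpread {I : Set Fˣ} {L : Submodule F (K × K)} :
    L ∈ andreSpread F K I ↔ L = Jinf F K ∨ L = J (AlgHom.id F K) 0 ∨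
      (∃ k ∈ normIn K I, L = J (FiniteField.frobeniusAlgHom F K) k) ∨
      (∃ k ∈ normIn K Iᶜ, L = J (AlgHom.id F K) k) := by
  simp only [andreSpread, normSurface, normIn, Set.mem_union, Set.mem_insert_iff,
    Set.mem_singleton_iff, Set.mem_iUnion, Set.mem_ofPred_eq, exists_prop]
  constructor
  · rintro (((h | h) | ⟨f, hf, k, hk, h⟩) | ⟨f, hf, k, hk, h⟩)
    · exact Or.inl h
    · exact Or.inr (Or.inl h)
    · exact Or.inr (Or.inr (Or.inl ⟨k, ⟨f, hf, hk⟩, h⟩))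
    · exact Or.inr (Or.inr (Or.inr ⟨k, ⟨f, hf, hk⟩, h⟩))
  · rintro (h | h | ⟨k, ⟨f, hf, hk⟩, h⟩ | ⟨k, ⟨f, hf, hk⟩, h⟩)
    · exact Or.inl (Or.inl (Or.inl h))
    · exact Or.inl (Or.inl (Or.inr h))
    · exact Or.inl (Or.inr ⟨f, hf, k, hk, h⟩)
    · exact Or.inr ⟨f, hf, k, hk, h⟩

/-- Both intersections with `A_I` have this shape: J(∞) and J(0) contribute 2, and each norm value
in the index set contributes q + 1. -/
lemma ncard_lines (hK : Module.finrank F K = 2) (σ : K →ₐ[F] K) (I : Set Fˣ) :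
    (insert (Jinf F K) (J σ '' insert 0 (normIn K I))).ncard
      = 2 + I.ncard * (Fintype.card F + 1) := by
  have := finite_of_finrank_two hK
  rw [Set.ncard_insert_of_notMem, Set.ncard_image_of_injective _ (J_injective σ),
    Set.ncard_insert_of_notMem, ncard_normIn hK]
  · ring
  · exact fun h => ne_zero_of_mem_normIn hK h rfl
  · rintro ⟨k, -, hk⟩
    exact Jinf_ne_J _ _ hk.symm

lemma spreadS_inter_andreSpread (hK : Module.finrank F K = 2) (I : Set Fˣ) :
    spreadS F K ∩ andreSpread F K I =
      insert (Jinf F K) (J (AlgHom.id F K) '' insert 0 (normIn K Iᶜ)) := by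
  ext L
  rw [Set.mem_inter_iff, mem_andreSpread]
  constructor
  · rintro ⟨hS, h | rfl | ⟨k, hk, rfl⟩ | ⟨k, hk, rfl⟩⟩
    · exact Or.inl h
    · exact Or.inr ⟨0, Or.inl rfl, rfl⟩
    · rcases hS with h | ⟨l, h⟩
      · exact absurd h.symm (Jinf_ne_J _ _)
      · exact absurd h.symm (J_ne_J_frobenius hK (ne_zero_of_mem_normIn hK hk) l)
    · exact Or.inr ⟨k, Or.inr hk, rfl⟩
  · rintro (rfl | ⟨k, rfl | hk, rfl⟩)
    · exact ⟨Or.inl rfl, Or.inl rfl⟩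
    · exact ⟨Or.inr ⟨0, rfl⟩, Or.inr (Or.inl rfl)⟩
    · exact ⟨Or.inr ⟨k, rfl⟩, Or.inr (Or.inr (Or.inr ⟨k, hk, rfl⟩))⟩

lemma spreadSq_inter_andreSpread (hK : Module.finrank F K = 2) (I : Set Fˣ) :
    spreadSq F K ∩ andreSpread F K I =
      insert (Jinf F K) (J (FiniteField.frobeniusAlgHom F K) '' insert 0 (normIn K I)) := by
  ext L
  rw [Set.mem_inter_iff, mem_andreSpread]
  constructor
  · rintro ⟨hS, h | rfl | ⟨k, hk, rfl⟩ | ⟨k, hk, rfl⟩⟩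
    · exact Or.inl h
    · exact Or.inr ⟨0, Or.inl rfl, J_zero _ _⟩
    · exact Or.inr ⟨k, Or.inr hk, rfl⟩
    · rcases hS with h | ⟨l, h⟩
      · exact absurd h.symm (Jinf_ne_J _ _)
      · have hk0 := ne_zero_of_mem_normIn hK hk
        -- J^q(0) does lie in `S`, so the case l = 0 must be excluded separately, through k ≠ 0.
        rcases eq_or_ne l 0 with rfl | hl
        · rw [J_zero _ (AlgHom.id F K)] at h
          exact absurd (J_injective _ h) hk0
        · exact absurd h (J_ne_J_frobenius hK hl k)
  · rintro (rfl | ⟨k, rfl | hk, rfl⟩)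
    · exact ⟨Or.inl rfl, Or.inl rfl⟩
    · exact ⟨Or.inr ⟨0, rfl⟩, Or.inr (Or.inl (J_zero _ _))⟩
    · exact ⟨Or.inr ⟨k, rfl⟩, Or.inr (Or.inr (Or.inl ⟨k, hk, rfl⟩))⟩

lemma andreSpread_subset (I : Set Fˣ) : andreSpread F K I ⊆ spreadS F K ∪ spreadSq F K := by
  intro L hL
  rcases mem_andreSpread.1 hL with rfl | rfl | ⟨k, -, rfl⟩ | ⟨k, -, rfl⟩
  · exact Or.inl (Or.inl rfl)
  · exact Or.inl (Or.inr ⟨0, rfl⟩)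
  · exact Or.inr (Or.inr ⟨k, rfl⟩)
  · exact Or.inl (Or.inr ⟨k, rfl⟩)

end Counting

end AndreSpread

/-! ### The intersection numbers and the bound -/

theorem lemma3p1 {F K : Type*} [Field F] [Fintype F] [Field K] [Algebra F K]
    (hK : Module.finrank F K = 2) (q : ℕ) (hq : Fintype.card F = q) (hq5 : 5 ≤ q)
    (I : Set Fˣ) (m : ℕ) (hm : I.ncard = m) (hm2 : 2 ≤ m) (hmq : (m : ℚ) ≤ ((q : ℚ) - 1) / 2) :
    (AndreSpread.IsRegularSpread F (AndreSpread.spreadS F K) ∧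
      (AndreSpread.spreadS F K ∩ AndreSpread.andreSpread F K I).ncard
        = 2 + (q - 1 - m) * (q + 1) ∧
      2 + (q - 1 - m) * (q + 1) > 2 * q + 2) ∧
    (AndreSpread.IsRegularSpread F (AndreSpread.spreadSq F K) ∧
      (AndreSpread.spreadSq F K ∩ AndreSpread.andreSpread F K I).ncard
        = 2 + m * (q + 1) ∧
      2 + m * (q + 1) > 2 * q + 2) ∧
    (∀ T : Set (Submodule F (K × K)), AndreSpread.IsRegularSpread F T →
      T ≠ AndreSpread.spreadS F K → T ≠ AndreSpread.spreadSq F K →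
      (T ∩ AndreSpread.andreSpread F K I).ncard ≤ 2 * q + 2) := by
  have hle : 2 * m + 1 ≤ q := by
    have : (2 * m + 1 : ℚ) ≤ q := by linarith
    exact_mod_cast this
  have hcompl : Iᶜ.ncard = q - 1 - m := by
    rw [Set.ncard_compl, hm, Nat.card_units, Nat.card_eq_fintype_card, hq]
  refine ⟨⟨AndreSpread.isRegularSpread_spreadS hK, ?_, ?_⟩,
    ⟨AndreSpread.isRegularSpread_spreadSq hK, ?_, ?_⟩, fun T hT hTS hTSq => ?_⟩
  · rw [AndreSpread.spreadS_inter_andreSpread hK, AndreSpread.ncard_lines hK, hcompl, hq]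
  · have := Nat.mul_le_mul_right (q + 1) (show 2 ≤ q - 1 - m by omega)
    omega
  · rw [AndreSpread.spreadSq_inter_andreSpread hK, AndreSpread.ncard_lines hK, hm, hq]
  · have := Nat.mul_le_mul_right (q + 1) hm2
    omega
  · have hfin : T.Finite := Set.finite_of_ncard_ne_zero (by rw [hT.isSpread.card_eq]; simp)
    have hF : 2 < Fintype.card F := by omega
    have h1 : (T ∩ AndreSpread.spreadS F K).ncard ≤ q + 1 := by
      by_contra! h
      exact hTS (hT.eq_spreadS hK hF (by rwa [hq]))
    have h2 : (T ∩ AndreSpread.spreadSq F K).ncard ≤ q + 1 := by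
      by_contra! h
      exact hTSq (hT.eq_spreadSq hK hF (by rwa [hq]))
    have hsub : T ∩ AndreSpread.andreSpread F K I ⊆
        (T ∩ AndreSpread.spreadS F K) ∪ (T ∩ AndreSpread.spreadSq F K) := by
      rw [← Set.inter_union_distrib_left]
      exact Set.inter_subset_inter_right _ (AndreSpread.andreSpread_subset I)
    have h3 := Set.ncard_le_ncard hsub ((hfin.inter_of_left _).union (hfin.inter_of_left _))
    have h4 := Set.ncard_union_le (T ∩ AndreSpread.spreadS F K) (T ∩ AndreSpread.spreadSq F K)
    omega
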